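/- Let $d\ge 1$, let $\Omega\subset\mathbb{R}^d$, and let $\mathcal{M}_+(\Omega)$ be the set of positive Radon measures of finite total mass on $\Omega$. Let $p\in[1,\infty)$ and let $c:\mathbb{R}\times\mathbb{R}\to[0,\infty)$ be a lower semicontinuous function (for the usual topology of $\mathbb{R}\times\mathbb{R}$) of the form $c(x,y)=D(x,y)^p$, where $D$ is a metric on the set $\mathbb{R}$. For $l>0$ and finite positive Borel measures $\mu',\nu'$ on $\mathbb{R}$ put $$\mathrm{OPT}_{l}(\mu',\nu')=\inf_{\gamma}\ \int_{\mathbb{R}^2} c\,d\gamma+l\big(\mu'(\mathbb{R})-\pi_{1\#}\gamma(\mathbb{R})\big)+l\big(\nu'(\mathbb{R})-\pi_{2\#}\gamma(\mathbb{R})\big),$$ where the infimum runs over all positive Borel measures $\gamma$ on $\mathbb{R}^2$ whose marginals satisfy $\pi_{1\#}\gamma\le\mu'$ and $\pi_{2\#}\gamma\le\nu'$ (setwise). Let $\sigma$ be a Borel probability measure on the unit sphere $\mathbb{S}^{d-1}$ with $\mathrm{supp}(\sigma)=\mathbb{S}^{d-1}$, and let $\lambda:\mathbb{S}^{d-1}\to(0,\infty)$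 be in $L^1(\sigma)$. For $\mu,\nu\in\mathcal{M}_+(\Omega)$ define $$\mathrm{SOPT}_\lambda(\mu,\nu)=\int_{\mathbb{S}^{d-1}}\mathrm{OPT}_{\lambda(\theta)}\big(\langle\theta,\cdot\rangle_\#\mu,\langle\theta,\cdot\rangle_\#\nu\big)\,d\sigma(\theta).$$ Then, for all $\mu,\nu\in\mathcal{M}_+(\Omega)$, the integrand is $\sigma$-measurable and $\mathrm{SOPT}_\lambda(\mu,\nu)<\infty$, and $(\mu,\nu)\mapsto \mathrm{SOPT}_\lambda(\mu,\nu)^{1/p}$ is a metric on $\mathcal{M}_+(\Omega)$. -/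

import Mathlib

open MeasureTheory
open scoped ENNReal

noncomputable section

namespace SlicedOPT

/-- `D` is a metric on the set `X` (no topology on `X` is involved). -/
structure IsMetric {X : Type*} (D : X → X → ℝ) : Prop where
  nonneg : ∀ x y, 0 ≤ D x y
  eq_zero_iff : ∀ x y, D x y = 0 ↔ x = y
  symm : ∀ x y, D x y = D y x
  triangle : ∀ x y z, D x z ≤ D x y + D y z

/-- The unit sphere `S^{d-1}` of `ℝ^d`, as a type. -/
abbrev UnitSphere (d : ℕ) : Type :=
  Metric.sphere (0 : EuclideanSpace ℝ (Fin d)) 1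

/-- The set `M₊(X)` of positive Radon measures of finite total mass on `X`. -/
def RadonMeasure (X : Type*) [TopologicalSpace X] [MeasurableSpace X] : Type _ :=
  {μ : Measure X // IsFiniteMeasure μ ∧ μ.Regular}

/-- The set `Γ_≤(μ, ν)` of measures `γ` on `ℝ × ℝ` whose first and second marginals are dominated
by `μ` and `ν`. For finite `μ` and `ν` such a `γ` is a finite Borel measure on the Polish space
`ℝ × ℝ`, hence it is Radon automatically. -/
def partialCouplings (μ ν : Measure ℝ) : Set (Measure (ℝ × ℝ)) :=
  {γ | γ.map Prod.fst ≤ μ ∧ γ.map Prod.snd ≤ ν}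

/-- The objective
`∫ c dγ + l (μ(ℝ) - (π₁)_# γ(ℝ)) + l (ν(ℝ) - (π₂)_# γ(ℝ))`, with values in `[0, ∞]`.
It is used for `c ≥ 0`, `l > 0`, finite `μ`, `ν`, and `γ ∈ Γ_≤(μ, ν)` only, so that nothing is
truncated. -/
def optCost (c : ℝ → ℝ → ℝ) (l : ℝ) (μ ν : Measure ℝ) (γ : Measure (ℝ × ℝ)) : ℝ≥0∞ :=
  (∫⁻ z, ENNReal.ofReal (c z.1 z.2) ∂γ)
    + ENNReal.ofReal l * (μ Set.univ - (γ.map Prod.fst) Set.univ)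
    + ENNReal.ofReal l * (ν Set.univ - (γ.map Prod.snd) Set.univ)

/-- The one-dimensional optimal partial transport problem `OPT_l(μ, ν)` with cost `c`. -/
def OPT (c : ℝ → ℝ → ℝ) (l : ℝ) (μ ν : Measure ℝ) : ℝ≥0∞ :=
  ⨅ γ ∈ partialCouplings μ ν, optCost c l μ ν γ

variable {d : ℕ} {Ω : Set (EuclideanSpace ℝ (Fin d))}

/-- The slice `⟨θ, ·⟩_# μ`. -/
def slice (θ : UnitSphere d) (μ : RadonMeasure Ω) : Measure ℝ :=
  μ.1.map (fun x : Ω => inner ℝ (θ : EuclideanSpace ℝ (Fin d)) (x : EuclideanSpace ℝ (Fin d)))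

/-- The integrand `θ ↦ OPT_{lam θ}(⟨θ, ·⟩_# μ, ⟨θ, ·⟩_# ν)`. -/
def slicedOPT (c : ℝ → ℝ → ℝ) (lam : UnitSphere d → ℝ) (μ ν : RadonMeasure Ω)
    (θ : UnitSphere d) : ℝ≥0∞ :=
  OPT c (lam θ) (slice θ μ) (slice θ ν)

/-- The sliced optimal partial transport cost `SOPT_lam(μ, ν)`, with values in `[0, ∞]`. -/
def SOPT (c : ℝ → ℝ → ℝ) (lam : UnitSphere d → ℝ) (σ : Measure (UnitSphere d))
    (μ ν : RadonMeasure Ω) : ℝ≥0∞ :=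
  ∫⁻ θ, slicedOPT c lam μ ν θ ∂σ

end SlicedOPT

end

namespace SlicedOPT

open ProbabilityTheory Filter Topology
open scoped NNReal BoundedContinuousFunction

/-! For a fixed direction, partial transport is balanced transport on the line with a reservoir
point attached: unmatched mass goes to or comes from the reservoir at cost l. The ground distance
`extDist` is D capped at (2l)^(1/p), with distance l^(1/p) to the reservoir; as p ≥ 1, it satisfies
the triangle inequality. `exists_extended_coupling` and `OPT_le_lintegral_extDist` pass between the
two problems, so gluing and Minkowski's inequality for the glued measure give `OPT_rpow_triangle`.
Minkowski in L^p(σ) then carries this over to the integral over directions.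

Measurability and definiteness rest on compactness. Since |⟨θ, x⟩| ≤ ‖x‖, the partial couplings of
the slices are tight uniformly in θ, and the cost is lower semicontinuous for weak convergence.
Hence minimizers exist and the optimal value is lower semicontinuous in (l, θ). If SOPT vanishes,
then for almost every θ a minimizer matches all mass and sits on the diagonal, so the slices agree.
Slices depend weakly continuously on θ, so full support of σ gives agreement for every θ, and
characteristic functions (Cramér–Wold) give μ = ν. Finiteness comes from testing with γ = 0. -/

/-! ### Triangle inequality in one dimension, via the reservoir point. -/

/-- Gluing of two couplings along a common marginal. -/
theorem exists_glue {X Y Z : Type*} [MeasurableSpace X] [MeasurableSpace Y] [MeasurableSpace Z]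
    [StandardBorelSpace X] [Nonempty X] [StandardBorelSpace Z] [Nonempty Z]
    (α : Measure (X × Y)) (β : Measure (Y × Z)) [IsFiniteMeasure α] [IsFiniteMeasure β]
    (h : α.map Prod.snd = β.map Prod.fst) :
    ∃ G : Measure (Y × X × Z), G.map (fun w => (w.2.1, w.1)) = α ∧
      G.map (fun w => (w.1, w.2.2)) = β := by
  set α' : Measure (Y × X) := α.map Prod.swap with hα'
  have hfin : IsFiniteMeasure α' := by rw [hα']; infer_instance
  have hfst : α'.fst = β.fst := by
    rw [Measure.fst, hα', Measure.map_map measurable_fst measurable_swap]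
    exact h
  -- The outer coordinates are made conditionally independent given the common middle one.
  refine ⟨β.fst ⊗ₘ (α'.condKernel ×ₖ β.condKernel), ?_, ?_⟩
  · have h1 : (β.fst ⊗ₘ (α'.condKernel ×ₖ β.condKernel)).map (Prod.map id Prod.fst) = α' := by
      rw [← Measure.compProd_map measurable_fst, ← Kernel.fst_eq, Kernel.fst_prod, ← hfst]
      exact α'.disintegrate _
    have h2 : (fun w : Y × X × Z => (w.2.1, w.1)) = Prod.swap ∘ (Prod.map id Prod.fst) := rfl
    rw [h2, ← Measure.map_map measurable_swap (by fun_prop), h1, hα',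
      Measure.map_map measurable_swap measurable_swap]
    simp
  · have h1 : (β.fst ⊗ₘ (α'.condKernel ×ₖ β.condKernel)).map (Prod.map id Prod.snd) = β := by
      rw [← Measure.compProd_map measurable_snd, ← Kernel.snd_eq, Kernel.snd_prod]
      exact β.disintegrate _
    exact h1

/-- The metric on `ℝ` with a reservoir point attached: `(x, true)` stands for the point `x`, and
every `(x, false)` for the reservoir. -/
noncomputable def extDist (D : ℝ → ℝ → ℝ) (p l : ℝ) (a b : ℝ × Bool) : ℝ≥0∞ :=
  bif a.2 then
    bif b.2 then min (ENNReal.ofReal (D a.1 b.1)) (ENNReal.ofReal (2 * l) ^ (1 / p))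
    else ENNReal.ofReal l ^ (1 / p)
  else bif b.2 then ENNReal.ofReal l ^ (1 / p) else 0

theorem two_mul_rpow_le {p l : ℝ} (hp : 1 ≤ p) :
    ENNReal.ofReal (2 * l) ^ (1 / p) ≤
      ENNReal.ofReal l ^ (1 / p) + ENNReal.ofReal l ^ (1 / p) := by
  have hp0 : 0 < p := by linarith
  rw [ENNReal.ofReal_mul (by norm_num), ENNReal.mul_rpow_of_nonneg _ _ (by positivity), ← two_mul]
  gcongr
  rw [show ENNReal.ofReal 2 = 2 by norm_num]
  calc (2 : ℝ≥0∞) ^ (1 / p) ≤ 2 ^ (1 : ℝ) := by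
        apply ENNReal.rpow_le_rpow_of_exponent_le (by norm_num)
        rw [div_le_one hp0]; exact hp
    _ = 2 := by simp

/-- The one case beyond a capped metric is the detour point, reservoir, point: its length 2 l^(1/p)
is at least the cap (2l)^(1/p) because p ≥ 1. -/
theorem extDist_triangle {D : ℝ → ℝ → ℝ} (hD : IsMetric D) {p l : ℝ} (hp : 1 ≤ p)
    (a b c : ℝ × Bool) : extDist D p l a c ≤ extDist D p l a b + extDist D p l b c := by
  obtain ⟨a, i⟩ := a
  obtain ⟨b, j⟩ := b
  obtain ⟨c, k⟩ := c
  have h2 := two_mul_rpow_le (l := l) hp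
  have hp0 : 0 < p := by linarith
  have h3 : ENNReal.ofReal (D a c) ≤ ENNReal.ofReal (D a b) + ENNReal.ofReal (D b c) := by
    rw [← ENNReal.ofReal_add (hD.nonneg _ _) (hD.nonneg _ _)]
    exact ENNReal.ofReal_le_ofReal (hD.triangle _ _ _)
  cases i <;> cases j <;> cases k <;> simp only [extDist, cond_true, cond_false]
  · simp
  · simp
  · simp
  · exact le_add_right le_rfl
  · simp
  · exact (min_le_right _ _).trans h2
  · exact le_add_left le_rfl
  · rcases le_total (ENNReal.ofReal (D a b)) (ENNReal.ofReal (2 * l) ^ (1 / p)) with h | h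
    · rcases le_total (ENNReal.ofReal (D b c)) (ENNReal.ofReal (2 * l) ^ (1 / p)) with h' | h'
      · rw [min_eq_left h, min_eq_left h']
        exact (min_le_left _ _).trans h3
      · rw [min_eq_right h']
        exact (min_le_right _ _).trans (le_add_left le_rfl)
    · rw [min_eq_right h]
      exact (min_le_right _ _).trans (le_add_right le_rfl)

theorem measurable_extDist {D : ℝ → ℝ → ℝ} (hD : Measurable fun z : ℝ × ℝ => D z.1 z.2)
    (p l : ℝ) : Measurable fun w : (ℝ × Bool) × (ℝ × Bool) => extDist D p l w.1 w.2 := by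
  have hD' : Measurable fun w : (ℝ × Bool) × (ℝ × Bool) => D w.1.1 w.2.1 :=
    hD.comp (g := fun z : ℝ × ℝ => D z.1 z.2)
      (f := fun w : (ℝ × Bool) × (ℝ × Bool) => (w.1.1, w.2.1)) (by fun_prop)
  have h1 : MeasurableSet {w : (ℝ × Bool) × (ℝ × Bool) | w.1.2 = true} :=
    (measurable_snd.comp measurable_fst) (measurableSet_singleton true)
  have h2 : MeasurableSet {w : (ℝ × Bool) × (ℝ × Bool) | w.2.2 = true} :=
    (measurable_snd.comp measurable_snd) (measurableSet_singleton true)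
  simp only [extDist, Bool.cond_eq_ite]
  exact Measurable.ite h1 (Measurable.ite h2 (hD'.ennreal_ofReal.min measurable_const)
    measurable_const) (Measurable.ite h2 measurable_const measurable_const)

/-- Keep the point-to-point mass that π moves at cost at most 2l and discard the rest: a discarded
pair pays l at each end, which is exactly the cap. The mass of π at the reservoir is unconstrained,
so padded plans are allowed. -/
theorem OPT_le_lintegral_extDist {D c : ℝ → ℝ → ℝ} {p l : ℝ} (hp : 1 ≤ p)
    (hD : IsMetric D) (hc : ∀ x y, c x y = D x y ^ p)
    (hcm : Measurable fun z : ℝ × ℝ => c z.1 z.2)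
    {μ ν : Measure ℝ} [IsFiniteMeasure μ] [IsFiniteMeasure ν]
    (π : Measure ((ℝ × Bool) × (ℝ × Bool)))
    (hμ : ∀ s, MeasurableSet s → π {w | w.1.2 = true ∧ w.1.1 ∈ s} = μ s)
    (hν : ∀ s, MeasurableSet s → π {w | w.2.2 = true ∧ w.2.1 ∈ s} = ν s) :
    OPT c l μ ν ≤ ∫⁻ w, extDist D p l w.1 w.2 ^ p ∂π := by
  have hp0 : 0 < p := by linarith
  have hcm' : Measurable fun w : (ℝ × Bool) × (ℝ × Bool) => c w.1.1 w.2.1 :=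
    hcm.comp (g := fun z : ℝ × ℝ => c z.1 z.2)
      (f := fun w : (ℝ × Bool) × (ℝ × Bool) => (w.1.1, w.2.1)) (by fun_prop)
  have h1 : MeasurableSet {w : (ℝ × Bool) × (ℝ × Bool) | w.1.2 = true} :=
    (measurable_snd.comp measurable_fst) (measurableSet_singleton true)
  have h2 : MeasurableSet {w : (ℝ × Bool) × (ℝ × Bool) | w.2.2 = true} :=
    (measurable_snd.comp measurable_snd) (measurableSet_singleton true)
  set T₁ := {w : (ℝ × Bool) × (ℝ × Bool) | w.1.2 = true}
  set T₂ := {w : (ℝ × Bool) × (ℝ × Bool) | w.2.2 = true}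
  set S := (T₁ ∩ T₂) ∩ {w | ENNReal.ofReal (c w.1.1 w.2.1) ≤ ENNReal.ofReal (2 * l)}
  have hS : MeasurableSet S :=
    (h1.inter h2).inter (measurableSet_le hcm'.ennreal_ofReal measurable_const)
  have hμ1 : π T₁ = μ Set.univ := by simpa [T₁] using hμ Set.univ MeasurableSet.univ
  have hν1 : π T₂ = ν Set.univ := by simpa [T₂] using hν Set.univ MeasurableSet.univ
  have hproj : Measurable fun w : (ℝ × Bool) × (ℝ × Bool) => (w.1.1, w.2.1) := by fun_prop
  set γ : Measure (ℝ × ℝ) := (π.restrict S).map (fun w => (w.1.1, w.2.1)) with hγ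
  have hγ1 : γ.map Prod.fst = (π.restrict S).map (fun w => w.1.1) := by
    rw [hγ, Measure.map_map measurable_fst hproj]; rfl
  have hγ2 : γ.map Prod.snd = (π.restrict S).map (fun w => w.2.1) := by
    rw [hγ, Measure.map_map measurable_snd hproj]; rfl
  have hmem : γ ∈ partialCouplings μ ν := by
    constructor
    · refine Measure.le_iff.2 fun s hs => ?_
      rw [hγ1, Measure.map_apply (by fun_prop) hs, Measure.restrict_apply
        ((by fun_prop : Measurable fun w : (ℝ × Bool) × (ℝ × Bool) => w.1.1) hs), ← hμ s hs]
      exact measure_mono fun w hw => ⟨hw.2.1.1, hw.1⟩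
    · refine Measure.le_iff.2 fun s hs => ?_
      rw [hγ2, Measure.map_apply (by fun_prop) hs, Measure.restrict_apply
        ((by fun_prop : Measurable fun w : (ℝ × Bool) × (ℝ × Bool) => w.2.1) hs), ← hν s hs]
      exact measure_mono fun w hw => ⟨hw.2.1.2, hw.1⟩
  refine (iInf₂_le γ hmem).trans ?_
  unfold optCost
  have e0 : ∫⁻ z, ENNReal.ofReal (c z.1 z.2) ∂γ
      = ∫⁻ w, S.indicator (fun w => ENNReal.ofReal (c w.1.1 w.2.1)) w ∂π := by
    rw [hγ, lintegral_map hcm.ennreal_ofReal hproj, lintegral_indicator hS]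
  have e1 : ENNReal.ofReal l * (μ Set.univ - (γ.map Prod.fst) Set.univ)
      ≤ ∫⁻ w, (T₁ \ S).indicator (fun _ => ENNReal.ofReal l) w ∂π := by
    rw [lintegral_indicator_const (h1.diff hS), hγ1, Measure.map_apply (by fun_prop) .univ,
      ← hμ1]
    simp only [Set.preimage_univ, Measure.restrict_apply_univ]
    gcongr
    exact le_measure_sdiff
  have e2 : ENNReal.ofReal l * (ν Set.univ - (γ.map Prod.snd) Set.univ)
      ≤ ∫⁻ w, (T₂ \ S).indicator (fun _ => ENNReal.ofReal l) w ∂π := by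
    rw [lintegral_indicator_const (h2.diff hS), hγ2, Measure.map_apply (by fun_prop) .univ,
      ← hν1]
    simp only [Set.preimage_univ, Measure.restrict_apply_univ]
    gcongr
    exact le_measure_sdiff
  rw [e0]
  refine (add_le_add (add_le_add le_rfl e1) e2).trans ?_
  rw [← lintegral_add_left (hcm'.ennreal_ofReal.indicator hS),
    ← lintegral_add_right _ (measurable_const.indicator (h2.diff hS))]
  refine lintegral_mono fun w => ?_
  obtain ⟨⟨x, i⟩, ⟨y, j⟩⟩ := w
  have hroot : ∀ t : ℝ≥0∞, (t ^ (1 / p)) ^ p = t := fun t => by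
    rw [← ENNReal.rpow_mul, one_div_mul_cancel hp0.ne', ENNReal.rpow_one]
  have hcD : ENNReal.ofReal (D x y) ^ p = ENNReal.ofReal (c x y) := by
    rw [hc, ENNReal.ofReal_rpow_of_nonneg (hD.nonneg _ _) hp0.le]
  have h2l : ENNReal.ofReal (2 * l) = ENNReal.ofReal l + ENNReal.ofReal l := by
    rw [ENNReal.ofReal_mul (by norm_num), ← two_mul]; norm_num
  have hmin : min (ENNReal.ofReal (D x y)) (ENNReal.ofReal (2 * l) ^ (1 / p)) ^ p
      = min (ENNReal.ofReal (c x y)) (ENNReal.ofReal l + ENNReal.ofReal l) := by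
    rw [(ENNReal.monotone_rpow_of_nonneg hp0.le).map_min, hcD, hroot, h2l]
  cases i <;> cases j <;>
    simp only [extDist, cond_true, cond_false, hroot, hmin, S, T₁, T₂, Set.indicator,
      Set.mem_inter_iff, Set.mem_sdiff, Set.mem_ofPred_eq]
  · simp
  · simp
  · simp
  · by_cases hle : ENNReal.ofReal (c x y) ≤ ENNReal.ofReal (2 * l)
    · have hle' := hle
      rw [h2l] at hle'
      simp only [hle, and_self, not_true_eq_false, and_false, if_true, if_false, add_zero]
      exact le_min le_rfl hle'
    · have hle' := (not_le.1 hle).le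
      rw [h2l] at hle'
      simp only [hle, and_self, and_false, not_false_eq_true, if_true, if_false, zero_add]
      exact le_min hle' le_rfl

/-- Unmatched mass of μ is sent to the reservoir, and unmatched mass of ν is drawn from it. The
extra mass m rests at the reservoir for free; it is there to let two plans be given the same middle
marginal. -/
theorem exists_extended_coupling {D c : ℝ → ℝ → ℝ} {p l : ℝ} (hp : 1 ≤ p)
    (hD : IsMetric D) (hc : ∀ x y, c x y = D x y ^ p)
    (hDm : Measurable fun z : ℝ × ℝ => D z.1 z.2)
    {μ ν : Measure ℝ} [IsFiniteMeasure μ] [IsFiniteMeasure ν]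
    {γ : Measure (ℝ × ℝ)} (hγ : γ ∈ partialCouplings μ ν) {m : ℝ≥0∞} (hm : m ≠ ∞) :
    ∃ π : Measure ((ℝ × Bool) × (ℝ × Bool)), IsFiniteMeasure π ∧
      π.map Prod.fst = μ.map (fun x => (x, true))
        + ((ν Set.univ - (γ.map Prod.snd) Set.univ) + m) • Measure.dirac (0, false) ∧
      π.map Prod.snd = ν.map (fun x => (x, true))
        + ((μ Set.univ - (γ.map Prod.fst) Set.univ) + m) • Measure.dirac (0, false) ∧
      ∫⁻ w, extDist D p l w.1 w.2 ^ p ∂π ≤ optCost c l μ ν γ := by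
  have hp0 : 0 < p := by linarith
  obtain ⟨h1, h2⟩ := hγ
  have hf1 : IsFiniteMeasure (γ.map Prod.fst) := isFiniteMeasure_of_le μ h1
  have hf2 : IsFiniteMeasure (γ.map Prod.snd) := isFiniteMeasure_of_le ν h2
  have hγf : IsFiniteMeasure γ := ⟨by
    have := measure_lt_top (γ.map Prod.fst) Set.univ
    rwa [Measure.map_apply measurable_fst .univ, Set.preimage_univ] at this⟩
  set μ' := μ - γ.map Prod.fst
  set ν' := ν - γ.map Prod.snd
  have hμf : IsFiniteMeasure μ' := isFiniteMeasure_of_le μ Measure.sub_le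
  have hνf : IsFiniteMeasure ν' := isFiniteMeasure_of_le ν Measure.sub_le
  have hμs : μ' + γ.map Prod.fst = μ := Measure.sub_add_cancel_of_le h1
  have hνs : ν' + γ.map Prod.snd = ν := Measure.sub_add_cancel_of_le h2
  have hμu : μ' Set.univ = μ Set.univ - (γ.map Prod.fst) Set.univ := Measure.sub_apply .univ h1
  have hνu : ν' Set.univ = ν Set.univ - (γ.map Prod.snd) Set.univ := Measure.sub_apply .univ h2
  have g0 : Measurable fun z : ℝ × ℝ => ((z.1, true), (z.2, true)) := by fun_prop
  have g1 : Measurable fun x : ℝ => ((x, true), ((0 : ℝ), false)) := by fun_prop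
  have g2 : Measurable fun y : ℝ => (((0 : ℝ), false), (y, true)) := by fun_prop
  have gi : Measurable fun x : ℝ => (x, true) := by fun_prop
  have hroot : ∀ t : ℝ≥0∞, (t ^ (1 / p)) ^ p = t := fun t => by
    rw [← ENNReal.rpow_mul, one_div_mul_cancel hp0.ne', ENNReal.rpow_one]
  have hem : Measurable fun w : (ℝ × Bool) × (ℝ × Bool) => extDist D p l w.1 w.2 ^ p :=
    (measurable_extDist hDm p l).pow_const p
  refine ⟨γ.map (fun z => ((z.1, true), (z.2, true))) + μ'.map (fun x => ((x, true), (0, false)))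
    + ν'.map (fun y => ((0, false), (y, true))) + m • Measure.dirac ((0, false), (0, false)),
    ?_, ?_, ?_, ?_⟩
  · have : IsFiniteMeasure (m • Measure.dirac (((0 : ℝ), false), ((0 : ℝ), false))) :=
      Measure.smul_finite _ hm
    infer_instance
  · rw [← hνu, Measure.map_add _ _ measurable_fst, Measure.map_add _ _ measurable_fst,
      Measure.map_add _ _ measurable_fst, Measure.map_map measurable_fst g0,
      Measure.map_map measurable_fst g1, Measure.map_map measurable_fst g2, Measure.map_smul,
      Measure.map_dirac' measurable_fst]
    have a1 : γ.map (Prod.fst ∘ fun z : ℝ × ℝ => ((z.1, true), (z.2, true)))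
        = (γ.map Prod.fst).map (fun x => (x, true)) := by
      rw [Measure.map_map gi measurable_fst]; rfl
    have a2 : (Prod.fst ∘ fun x : ℝ => ((x, true), ((0 : ℝ), false))) = fun x => (x, true) := rfl
    have a3 : (Prod.fst ∘ fun y : ℝ => (((0 : ℝ), false), (y, true))) = fun _ => (0, false) := rfl
    rw [a1, a2, a3, Measure.map_const, ← Measure.map_add _ _ gi, add_comm (γ.map Prod.fst), hμs,
      add_smul, add_assoc]
  · rw [← hμu, Measure.map_add _ _ measurable_snd, Measure.map_add _ _ measurable_snd,
      Measure.map_add _ _ measurable_snd, Measure.map_map measurable_snd g0,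
      Measure.map_map measurable_snd g1, Measure.map_map measurable_snd g2, Measure.map_smul,
      Measure.map_dirac' measurable_snd]
    have a1 : γ.map (Prod.snd ∘ fun z : ℝ × ℝ => ((z.1, true), (z.2, true)))
        = (γ.map Prod.snd).map (fun x => (x, true)) := by
      rw [Measure.map_map gi measurable_snd]; rfl
    have a2 : (Prod.snd ∘ fun x : ℝ => ((x, true), ((0 : ℝ), false))) = fun _ => (0, false) := rfl
    have a3 : (Prod.snd ∘ fun y : ℝ => (((0 : ℝ), false), (y, true))) = fun y => (y, true) := rfl
    rw [a1, a2, a3, Measure.map_const, add_right_comm (Measure.map _ (γ.map Prod.snd)),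
      ← Measure.map_add _ _ gi, add_comm (γ.map Prod.snd), hνs, add_smul, add_assoc]
  · rw [lintegral_add_measure, lintegral_add_measure, lintegral_add_measure,
      lintegral_map hem g0, lintegral_map hem g1, lintegral_map hem g2, lintegral_smul_measure,
      lintegral_dirac' _ hem]
    simp only [extDist, cond_true, cond_false, hroot, lintegral_const, ENNReal.zero_rpow_of_pos hp0,
      smul_zero, add_zero, hμu, hνu, optCost]
    gcongr with z
    calc _ ≤ ENNReal.ofReal (D z.1 z.2) ^ p := by gcongr; exact min_le_left _ _
      _ = _ := by rw [hc, ENNReal.ofReal_rpow_of_nonneg (hD.nonneg _ _) hp0.le]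

theorem map_pad_apply {μ : Measure ℝ} {t : ℝ≥0∞} {s : Set ℝ} (hs : MeasurableSet s) :
    (μ.map (fun x => (x, true)) + t • Measure.dirac ((0 : ℝ), false))
      {a : ℝ × Bool | a.2 = true ∧ a.1 ∈ s} = μ s := by
  have hm : MeasurableSet {a : ℝ × Bool | a.2 = true ∧ a.1 ∈ s} :=
    (measurable_snd (measurableSet_singleton true)).inter (measurable_fst hs)
  rw [Measure.add_apply, Measure.map_apply (by fun_prop) hm, Measure.smul_apply,
    Measure.dirac_apply' _ hm]
  simp

/-- The triangle inequality for `OPT ^ (1 / p)`. -/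
theorem OPT_rpow_triangle {D c : ℝ → ℝ → ℝ} {p l : ℝ} (hp : 1 ≤ p)
    (hD : IsMetric D) (hc : ∀ x y, c x y = D x y ^ p)
    (hcm : Measurable fun z : ℝ × ℝ => c z.1 z.2)
    (μ ν ρ : Measure ℝ) [IsFiniteMeasure μ] [IsFiniteMeasure ν] [IsFiniteMeasure ρ] :
    OPT c l μ ρ ^ (1 / p) ≤ OPT c l μ ν ^ (1 / p) + OPT c l ν ρ ^ (1 / p) := by
  have hp0 : 0 < p := by linarith
  have hDm : Measurable fun z : ℝ × ℝ => D z.1 z.2 := by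
    have : (fun z : ℝ × ℝ => D z.1 z.2) = fun z => c z.1 z.2 ^ (1 / p) := by
      funext z
      rw [hc, ← Real.rpow_mul (hD.nonneg _ _), mul_one_div_cancel hp0.ne', Real.rpow_one]
    rw [this]
    exact hcm.pow_const _
  have key : ∀ γ ∈ partialCouplings μ ν, ∀ γ' ∈ partialCouplings ν ρ,
      OPT c l μ ρ ^ (1 / p) ≤ optCost c l μ ν γ ^ (1 / p) + optCost c l ν ρ γ' ^ (1 / p) := by
    intro γ hγ γ' hγ'
    -- Each plan is padded by the other's leftover, so both have the same reservoir mass in the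
    -- middle: the part of μ unmatched by γ plus the part of ρ unmatched by γ'.
    obtain ⟨α, hα, hα1, hα2, hαc⟩ := exists_extended_coupling (l := l) hp hD hc hDm hγ
      (m := ρ Set.univ - (γ'.map Prod.snd) Set.univ)
      (ne_top_of_le_ne_top (measure_ne_top ρ _) tsub_le_self)
    obtain ⟨β, hβ, hβ1, hβ2, hβc⟩ := exists_extended_coupling (l := l) hp hD hc hDm hγ'
      (m := μ Set.univ - (γ.map Prod.fst) Set.univ)
      (ne_top_of_le_ne_top (measure_ne_top μ _) tsub_le_self)
    obtain ⟨G, hG1, hG2⟩ := exists_glue α β (by rw [hα2, hβ1, add_comm (ρ Set.univ - _)])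
    have me := measurable_extDist hDm p l
    have m1 : Measurable fun w : (ℝ × Bool) × (ℝ × Bool) × (ℝ × Bool) => (w.2.1, w.1) := by
      fun_prop
    have m2 : Measurable fun w : (ℝ × Bool) × (ℝ × Bool) × (ℝ × Bool) => (w.1, w.2.2) := by
      fun_prop
    have hOPT : OPT c l μ ρ ≤ ∫⁻ w, extDist D p l w.1 w.2 ^ p ∂(G.map Prod.snd) := by
      refine OPT_le_lintegral_extDist hp hD hc hcm _ (fun s hs => ?_) (fun s hs => ?_)
      · have hm : MeasurableSet {a : ℝ × Bool | a.2 = true ∧ a.1 ∈ s} :=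
          (measurable_snd (measurableSet_singleton true)).inter (measurable_fst hs)
        rw [← map_pad_apply (μ := μ) hs, ← hα1, ← hG1, Measure.map_map measurable_fst m1,
          Measure.map_apply (by fun_prop) hm]
        exact Measure.map_apply measurable_snd (measurable_fst hm)
      · have hm : MeasurableSet {a : ℝ × Bool | a.2 = true ∧ a.1 ∈ s} :=
          (measurable_snd (measurableSet_singleton true)).inter (measurable_fst hs)
        rw [← map_pad_apply (μ := ρ) hs, ← hβ2, ← hG2, Measure.map_map measurable_snd m2,
          Measure.map_apply (by fun_prop) hm]
        exact Measure.map_apply measurable_snd (measurable_snd hm)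
    rw [lintegral_map (me.pow_const p) measurable_snd] at hOPT
    calc OPT c l μ ρ ^ (1 / p)
        ≤ (∫⁻ w, (extDist D p l w.2.1 w.1 + extDist D p l w.1 w.2.2) ^ p ∂G) ^ (1 / p) := by
          refine ENNReal.rpow_le_rpow (hOPT.trans (lintegral_mono fun w => ?_)) (by positivity)
          exact ENNReal.rpow_le_rpow (extDist_triangle hD hp _ _ _) hp0.le
      _ ≤ (∫⁻ w, extDist D p l w.2.1 w.1 ^ p ∂G) ^ (1 / p)
          + (∫⁻ w, extDist D p l w.1 w.2.2 ^ p ∂G) ^ (1 / p) :=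
          ENNReal.lintegral_Lp_add_le (me.comp m1).aemeasurable (me.comp m2).aemeasurable hp
      _ = (∫⁻ w, extDist D p l w.1 w.2 ^ p ∂α) ^ (1 / p)
          + (∫⁻ w, extDist D p l w.1 w.2 ^ p ∂β) ^ (1 / p) := by
          rw [← hG1, ← hG2, lintegral_map (me.pow_const p) m1, lintegral_map (me.pow_const p) m2]
      _ ≤ _ := by gcongr
  -- Moving one summand to the left and inverting the root leaves a bare infimum on the right, so
  -- the two infima can be treated one after the other.
  have aux : ∀ {x a b : ℝ≥0∞}, x ≤ a ^ (1 / p) + b ↔ (x - b) ^ p ≤ a := by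
    intro x a b
    rw [← tsub_le_iff_right, one_div, ENNReal.le_rpow_inv_iff hp0]
  rw [aux]
  refine le_iInf₂ fun γ hγ => ?_
  rw [← aux, add_comm, aux]
  refine le_iInf₂ fun γ' hγ' => ?_
  rw [← aux, add_comm]
  exact key γ hγ γ' hγ'

/-! ### Weak topology: closedness of the constraints, semicontinuity of the cost. -/

/-- A finite Borel measure is dominated by another one as soon as it is so against nonnegative
bounded continuous functions. -/
theorem le_of_forall_lintegral_le {X : Type*} [PseudoMetricSpace X] [MeasurableSpace X]
    [BorelSpace X] {μ ν : Measure X} [IsFiniteMeasure μ] [IsFiniteMeasure ν]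
    (h : ∀ f : X →ᵇ ℝ≥0, ∫⁻ x, f x ∂μ ≤ ∫⁻ x, f x ∂ν) : μ ≤ ν := by
  -- Indicators of closed sets are limits of bounded continuous functions; inner regularity then
  -- reaches all measurable sets.
  have hcl : ∀ F : Set X, IsClosed F → μ F ≤ ν F := fun F hF =>
    le_of_tendsto_of_tendsto' (HasOuterApproxClosed.tendsto_lintegral_apprSeq hF μ)
      (HasOuterApproxClosed.tendsto_lintegral_apprSeq hF ν) fun n => h _
  refine Measure.le_iff.2 fun s hs => ?_
  rw [hs.measure_eq_iSup_isClosed_of_ne_top (measure_ne_top μ s)]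
  exact iSup₂_le fun F hFs => iSup_le fun hF => (hcl F hF).trans (measure_mono hFs)

theorem le_iff_forall_lintegral_le {X : Type*} [PseudoMetricSpace X] [MeasurableSpace X]
    [BorelSpace X] {μ ν : Measure X} [IsFiniteMeasure μ] [IsFiniteMeasure ν] :
    μ ≤ ν ↔ ∀ f : X →ᵇ ℝ≥0, ∫⁻ x, f x ∂μ ≤ ∫⁻ x, f x ∂ν :=
  ⟨fun h _ => lintegral_mono' h le_rfl, le_of_forall_lintegral_le⟩

theorem isClosed_setOf_finiteMeasure_le {X : Type*} [PseudoMetricSpace X] [MeasurableSpace X]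
    [BorelSpace X] :
    IsClosed {q : FiniteMeasure X × FiniteMeasure X | (q.1 : Measure X) ≤ q.2} := by
  simp only [le_iff_forall_lintegral_le, Set.ofPred_forall]
  exact isClosed_iInter fun f => isClosed_le
    ((FiniteMeasure.continuous_lintegral_boundedContinuousFunction f).comp continuous_fst)
    ((FiniteMeasure.continuous_lintegral_boundedContinuousFunction f).comp continuous_snd)

theorem isClosed_partialCouplings :
    IsClosed {q : (FiniteMeasure ℝ × FiniteMeasure ℝ) × FiniteMeasure (ℝ × ℝ) |
      (q.2 : Measure (ℝ × ℝ)) ∈ partialCouplings q.1.1 q.1.2} := by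
  have h1 : Continuous fun q : (FiniteMeasure ℝ × FiniteMeasure ℝ) × FiniteMeasure (ℝ × ℝ) =>
      (q.2.map Prod.fst, q.1.1) :=
    ((FiniteMeasure.continuous_map continuous_fst).comp continuous_snd).prodMk
      (continuous_fst.comp continuous_fst)
  have h2 : Continuous fun q : (FiniteMeasure ℝ × FiniteMeasure ℝ) × FiniteMeasure (ℝ × ℝ) =>
      (q.2.map Prod.snd, q.1.2) :=
    ((FiniteMeasure.continuous_map continuous_snd).comp continuous_snd).prodMk
      (continuous_snd.comp continuous_fst)
  exact (isClosed_setOf_finiteMeasure_le.preimage h1).inter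
    (isClosed_setOf_finiteMeasure_le.preimage h2)

/-- The `k`-Lipschitz regularization of the truncation of `f` at level `k`. -/
noncomputable def lipReg {X : Type*} [PseudoMetricSpace X] (f : X → ℝ) (k : ℕ) (x : X) : ℝ :=
  ⨅ y, (min (f y) k + k * dist x y)

section lipReg
variable {X : Type*} [PseudoMetricSpace X] {f : X → ℝ}

theorem bddBelow_lipReg (hf : ∀ x, 0 ≤ f x) (k : ℕ) (x : X) :
    BddBelow (Set.range fun y => min (f y) k + k * dist x y) :=
  ⟨0, by rintro _ ⟨y, rfl⟩; have := hf y; positivity⟩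

theorem lipReg_nonneg (hf : ∀ x, 0 ≤ f x) (k : ℕ) (x : X) : 0 ≤ lipReg f k x :=
  Real.iInf_nonneg fun y => by have := hf y; positivity

theorem lipReg_le_min (hf : ∀ x, 0 ≤ f x) (k : ℕ) (x : X) : lipReg f k x ≤ min (f x) k :=
  (ciInf_le (bddBelow_lipReg hf k x) x).trans (by simp)

theorem lipReg_lipschitz (hf : ∀ x, 0 ≤ f x) (k : ℕ) : LipschitzWith k (lipReg f k) := by
  refine LipschitzWith.of_le_add_mul _ fun x y => ?_
  have : Nonempty X := ⟨x⟩
  rw [← sub_le_iff_le_add]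
  refine le_ciInf fun z => ?_
  rw [sub_le_iff_le_add]
  refine (ciInf_le (bddBelow_lipReg hf k x) z).trans ?_
  have := mul_le_mul_of_nonneg_left (dist_triangle x y z) (Nat.cast_nonneg (α := ℝ) k)
  simp only [NNReal.coe_natCast]
  linarith

theorem lipReg_mono (hf : ∀ x, 0 ≤ f x) : Monotone (lipReg f) := fun i j hij x => by
  have : Nonempty X := ⟨x⟩
  have hij' : (i : ℝ) ≤ j := Nat.cast_le.2 hij
  exact ciInf_mono (bddBelow_lipReg hf i x) fun y => by gcongr

theorem iSup_lipReg (hf : ∀ x, 0 ≤ f x) (hlsc : LowerSemicontinuous f) (x : X) :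
    ⨆ k, ENNReal.ofReal (lipReg f k x) = ENNReal.ofReal (f x) := by
  have : Nonempty X := ⟨x⟩
  refine le_antisymm (iSup_le fun k => ENNReal.ofReal_le_ofReal
    ((lipReg_le_min hf k x).trans (min_le_left _ _))) ?_
  refine le_of_forall_lt fun a ha => ?_
  obtain ⟨b, hab, hb⟩ := exists_between ha
  have hbt : b ≠ ∞ := (hb.trans_le le_top).ne
  have hbf : b.toReal < f x := by
    rw [← ENNReal.ofReal_toReal hbt] at hb
    exact (ENNReal.ofReal_lt_ofReal_iff_of_nonneg ENNReal.toReal_nonneg).1 hb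
  obtain ⟨r, hr, hball⟩ := Metric.eventually_nhds_iff_ball.1 (hlsc x _ hbf)
  -- The bound k ≥ b keeps the truncation of f at least b on the ball where f > b; the bound k ≥ b /
  -- r makes the penalty at least b off that ball.
  obtain ⟨k, hk⟩ := exists_nat_ge (max b.toReal (b.toReal / r))
  refine lt_of_lt_of_le hab (le_iSup_of_le k ?_)
  rw [← ENNReal.ofReal_toReal hbt]
  refine ENNReal.ofReal_le_ofReal (le_ciInf fun y => ?_)
  have hk1 := (le_max_left _ _).trans hk
  have hk2 := (le_max_right _ _).trans hk
  rw [div_le_iff₀ hr] at hk2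
  by_cases hy : y ∈ Metric.ball x r
  · have h1 : b.toReal ≤ min (f y) k := le_min (hball y hy).le hk1
    have : 0 ≤ (k : ℝ) * dist x y := by positivity
    linarith
  · rw [Metric.mem_ball, not_lt, dist_comm] at hy
    have h1 : 0 ≤ min (f y) (k : ℝ) := le_min (hf y) (Nat.cast_nonneg k)
    have := mul_le_mul_of_nonneg_left hy (Nat.cast_nonneg (α := ℝ) k)
    linarith

/-- The integral of a nonnegative lower semicontinuous function is lower semicontinuous for the
weak topology. -/
theorem lowerSemicontinuous_lintegral [MeasurableSpace X] [BorelSpace X]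
    (hf : ∀ x, 0 ≤ f x) (hlsc : LowerSemicontinuous f) :
    LowerSemicontinuous fun γ : FiniteMeasure X => ∫⁻ x, ENNReal.ofReal (f x) ∂(γ : Measure X) := by
  have hcont : ∀ k, Continuous (lipReg f k) := fun k => (lipReg_lipschitz hf k).continuous
  have h : ∀ γ : FiniteMeasure X, ∫⁻ x, ENNReal.ofReal (f x) ∂(γ : Measure X)
      = ⨆ k, ∫⁻ x, ENNReal.ofReal (lipReg f k x) ∂(γ : Measure X) := fun γ => by
    rw [← lintegral_iSup (fun k => (hcont k).measurable.ennreal_ofReal)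
      fun i j hij x => ENNReal.ofReal_le_ofReal (lipReg_mono hf hij x)]
    simp_rw [iSup_lipReg hf hlsc]
  simp_rw [h]
  refine lowerSemicontinuous_iSup fun k => Continuous.lowerSemicontinuous ?_
  have hb : ∀ x y, dist (lipReg f k x).toNNReal (lipReg f k y).toNNReal ≤ k := by
    intro x y
    rw [NNReal.dist_eq, Real.coe_toNNReal _ (lipReg_nonneg hf k x),
      Real.coe_toNNReal _ (lipReg_nonneg hf k y), abs_le]
    have h1 := lipReg_nonneg hf k x
    have h2 := lipReg_nonneg hf k y
    have h3 := (lipReg_le_min hf k x).trans (min_le_right _ _)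
    have h4 := (lipReg_le_min hf k y).trans (min_le_right _ _)
    constructor <;> linarith
  exact FiniteMeasure.continuous_lintegral_boundedContinuousFunction
    (BoundedContinuousFunction.mkOfBound
      ⟨fun x => (lipReg f k x).toNNReal, continuous_real_toNNReal.comp (hcont k)⟩ k hb)

end lipReg

/-- Only the transport term needs semicontinuity. The penalties are continuous: both marginals of γ
have the total mass of γ, and mass is finite and weakly continuous. -/
theorem lowerSemicontinuous_optCost {c : ℝ → ℝ → ℝ} (hc : ∀ x y, 0 ≤ c x y)
    (hlsc : LowerSemicontinuous fun z : ℝ × ℝ => c z.1 z.2) :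
    LowerSemicontinuous fun q : (ℝ × FiniteMeasure ℝ × FiniteMeasure ℝ) × FiniteMeasure (ℝ × ℝ) =>
      optCost c q.1.1 q.1.2.1 q.1.2.2 q.2 := by
  have hm : ∀ {Y : Type} [TopologicalSpace Y] [MeasurableSpace Y] [OpensMeasurableSpace Y],
      Continuous fun γ : FiniteMeasure Y => (γ : Measure Y) Set.univ := by
    intro Y _ _ _
    simp_rw [← FiniteMeasure.ennreal_mass]
    exact ENNReal.continuous_coe.comp FiniteMeasure.continuous_mass
  have hmap : ∀ (g : ℝ × ℝ → ℝ) (_ : Measurable g) (γ : FiniteMeasure (ℝ × ℝ)),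
      ((γ : Measure (ℝ × ℝ)).map g) Set.univ = (γ : Measure (ℝ × ℝ)) Set.univ := by
    intro g hg γ
    rw [Measure.map_apply hg .univ, Set.preimage_univ]
  have hpen : ∀ g : (ℝ × FiniteMeasure ℝ × FiniteMeasure ℝ) × FiniteMeasure (ℝ × ℝ) →
      FiniteMeasure ℝ, Continuous g →
      Continuous fun q : (ℝ × FiniteMeasure ℝ × FiniteMeasure ℝ) × FiniteMeasure (ℝ × ℝ) =>
        ENNReal.ofReal q.1.1 * ((g q : Measure ℝ) Set.univ - (q.2 : Measure (ℝ × ℝ)) Set.univ) := by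
    intro g hg
    refine continuous_iff_continuousAt.2 fun q => ?_
    have h1 : ContinuousAt (fun q : (ℝ × FiniteMeasure ℝ × FiniteMeasure ℝ) ×
        FiniteMeasure (ℝ × ℝ) => ENNReal.ofReal q.1.1) q :=
      (ENNReal.continuous_ofReal.comp (continuous_fst.comp continuous_fst)).continuousAt
    exact ENNReal.Tendsto.mul h1
      (Or.inr (ne_top_of_le_ne_top (measure_ne_top (g q : Measure ℝ) _) tsub_le_self))
      (ENNReal.Tendsto.sub (hm.comp hg).continuousAt (hm.comp continuous_snd).continuousAt
        (Or.inl (measure_ne_top _ _))) (Or.inr ENNReal.ofReal_ne_top)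
  simp only [optCost, hmap _ measurable_fst, hmap _ measurable_snd]
  refine LowerSemicontinuous.add (LowerSemicontinuous.add ?_ ?_) ?_
  · exact (lowerSemicontinuous_lintegral (f := fun z : ℝ × ℝ => c z.1 z.2)
      (fun z => hc _ _) hlsc).comp continuous_snd
  · exact (hpen _ (by fun_prop)).lowerSemicontinuous
  · exact (hpen _ (by fun_prop)).lowerSemicontinuous

/-! ### Slices: compactness, minimizers and measurability in the direction. -/

variable {d : ℕ} {Ω : Set (EuclideanSpace ℝ (Fin d))}

instance (μ : RadonMeasure Ω) : IsFiniteMeasure μ.1 := μ.2.1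

theorem continuous_slice_fun (θ : UnitSphere d) :
    Continuous fun x : Ω =>
      inner ℝ (θ : EuclideanSpace ℝ (Fin d)) (x : EuclideanSpace ℝ (Fin d)) :=
  continuous_const.inner continuous_subtype_val

instance (θ : UnitSphere d) (μ : RadonMeasure Ω) : IsFiniteMeasure (slice θ μ) := by
  unfold slice; infer_instance

/-- The slice as a bundled finite measure. -/
noncomputable def finiteSlice (θ : UnitSphere d) (μ : RadonMeasure Ω) : FiniteMeasure ℝ :=
  ⟨slice θ μ, inferInstance⟩

/-- Dominated convergence, tested against bounded continuous functions. -/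
theorem continuous_finiteSlice (μ : RadonMeasure Ω) :
    Continuous fun θ : UnitSphere d => finiteSlice θ μ := by
  refine FiniteMeasure.continuous_iff_forall_continuous_integral.2 fun f => ?_
  have h : ∀ θ : UnitSphere d, ∫ t, f t ∂(finiteSlice θ μ : Measure ℝ)
      = ∫ x : Ω, f (inner ℝ (θ : EuclideanSpace ℝ (Fin d)) (x : EuclideanSpace ℝ (Fin d))) ∂μ.1 :=
    fun θ => integral_map (continuous_slice_fun θ).measurable.aemeasurable
      f.continuous.measurable.aestronglyMeasurable
  simp_rw [h]
  refine continuous_of_dominated (bound := fun _ => ‖f‖) (fun θ => ?_) (fun θ => ?_)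
    (integrable_const _) ?_
  · exact (f.continuous.comp (continuous_slice_fun θ)).aestronglyMeasurable
  · exact ae_of_all _ fun x => f.norm_coe_le_norm _
  · exact ae_of_all _ fun x => f.continuous.comp (continuous_subtype_val.inner continuous_const)

/-- All partial couplings of the slices of two measures lie in one compact set. -/
theorem exists_isCompact_partialCouplings_slice (μ ν : RadonMeasure Ω) :
    ∃ K : Set (FiniteMeasure (ℝ × ℝ)), IsCompact K ∧
      ∀ θ : UnitSphere d, ∀ γ : FiniteMeasure (ℝ × ℝ),
        (γ : Measure (ℝ × ℝ)) ∈ partialCouplings (slice θ μ) (slice θ ν) → γ ∈ K := by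
  set T : ℕ → Set Ω := fun n => {x | (n : ℝ) < ‖(x : EuclideanSpace ℝ (Fin d))‖} with hT
  have hTm : ∀ n, MeasurableSet (T n) := fun n =>
    (isOpen_lt continuous_const (continuous_norm.comp continuous_subtype_val)).measurableSet
  have htail : ∀ ρ : RadonMeasure Ω, Tendsto (fun n => ρ.1 (T n)) atTop (𝓝 0) := by
    intro ρ
    have hemp : ⋂ n, T n = ∅ := by
      refine Set.eq_empty_of_forall_notMem fun x hx => ?_
      obtain ⟨n, hn⟩ := exists_nat_ge ‖(x : EuclideanSpace ℝ (Fin d))‖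
      exact absurd (Set.mem_iInter.1 hx n) (not_lt.2 hn)
    have hanti : Antitone T := fun i j hij x (hx : (j : ℝ) < _) =>
      show (i : ℝ) < _ from lt_of_le_of_lt (Nat.cast_le.2 hij) hx
    have := tendsto_measure_iInter_atTop (μ := ρ.1) (fun n => (hTm n).nullMeasurableSet) hanti
      ⟨0, measure_ne_top _ _⟩
    rwa [hemp, measure_empty] at this
  -- A pair outside the ball of radius n has a coordinate exceeding n in absolute value, the norm on
  -- ℝ × ℝ being the maximum. Hence the tails of μ and ν bound those of every coupling,
  -- independently of θ.
  set u : ℕ → ℝ≥0 := fun n => (μ.1 (T n)).toNNReal + (ν.1 (T n)).toNNReal with hu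
  have hu0 : Tendsto u atTop (𝓝 0) := by
    have h1 := (ENNReal.tendsto_toNNReal ENNReal.zero_ne_top).comp (htail μ)
    have h2 := (ENNReal.tendsto_toNNReal ENNReal.zero_ne_top).comp (htail ν)
    simpa using h1.add h2
  refine ⟨_, isCompact_setOfPred_finiteMeasure_mass_le_compl_isCompact_le
    (E := ℝ × ℝ) (K := fun n : ℕ => Metric.closedBall 0 n) (μ.1 Set.univ).toNNReal hu0
    (fun n => isCompact_closedBall _ _)
    (Or.inr fun i j hij => Metric.closedBall_subset_closedBall (Nat.cast_le.2 hij)), ?_⟩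
  rintro θ γ ⟨h1, h2⟩
  have hsl : ∀ (ρ : RadonMeasure Ω) (n : ℕ), slice θ ρ {t | (n : ℝ) < |t|} ≤ ρ.1 (T n) := by
    intro ρ n
    have hms : MeasurableSet {t : ℝ | (n : ℝ) < |t|} :=
      measurableSet_lt measurable_const measurable_norm
    refine (Measure.map_apply (continuous_slice_fun θ).measurable hms).trans_le ?_
    refine measure_mono fun x (hx : (n : ℝ) < |_|) => show (n : ℝ) < _ from lt_of_lt_of_le hx ?_
    have hθ : ‖(θ : EuclideanSpace ℝ (Fin d))‖ = 1 := by simp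
    have := abs_real_inner_le_norm (θ : EuclideanSpace ℝ (Fin d)) (x : EuclideanSpace ℝ (Fin d))
    rwa [hθ, one_mul] at this
  constructor
  · rw [← ENNReal.coe_le_coe, FiniteMeasure.ennreal_mass, ENNReal.coe_toNNReal (measure_ne_top _ _)]
    have := h1 Set.univ
    rwa [Measure.map_apply measurable_fst .univ, slice,
      Measure.map_apply (continuous_slice_fun θ).measurable .univ] at this
  · intro n
    rw [← ENNReal.coe_le_coe, FiniteMeasure.ennreal_coeFn_eq_coeFn_toMeasure, hu,
      ENNReal.coe_add, ENNReal.coe_toNNReal (measure_ne_top _ _),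
      ENNReal.coe_toNNReal (measure_ne_top _ _)]
    have hms : MeasurableSet {t : ℝ | (n : ℝ) < |t|} :=
      measurableSet_lt measurable_const measurable_norm
    have hsub : (Metric.closedBall (0 : ℝ × ℝ) n)ᶜ ⊆
        Prod.fst ⁻¹' {t : ℝ | (n : ℝ) < |t|} ∪ Prod.snd ⁻¹' {t : ℝ | (n : ℝ) < |t|} := by
      intro z hz
      simpa [Prod.norm_def, lt_max_iff, -not_and, not_and_or] using hz
    refine (measure_mono hsub).trans ((measure_union_le _ _).trans (add_le_add ?_ ?_))
    · rw [← Measure.map_apply measurable_fst hms]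
      exact (h1 _).trans (hsl μ n)
    · rw [← Measure.map_apply measurable_snd hms]
      exact (h2 _).trans (hsl ν n)

theorem isFiniteMeasure_of_mem_partialCouplings {μ ν : Measure ℝ} [IsFiniteMeasure μ]
    {γ : Measure (ℝ × ℝ)} (hγ : γ ∈ partialCouplings μ ν) : IsFiniteMeasure γ := ⟨by
  have := (hγ.1 Set.univ).trans_lt (measure_lt_top μ _)
  rwa [Measure.map_apply measurable_fst .univ, Set.preimage_univ] at this⟩

theorem OPT_le_optCost {c : ℝ → ℝ → ℝ} {l : ℝ} {μ ν : Measure ℝ} {γ : Measure (ℝ × ℝ)}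
    (hγ : γ ∈ partialCouplings μ ν) : OPT c l μ ν ≤ optCost c l μ ν γ :=
  iInf₂_le γ hγ

theorem zero_mem_partialCouplings (μ ν : Measure ℝ) : (0 : Measure (ℝ × ℝ)) ∈
    partialCouplings μ ν := by
  simp [partialCouplings, Measure.zero_le]

theorem isClosed_partialCouplings_slice (μ ν : RadonMeasure Ω) :
    IsClosed {q : UnitSphere d × FiniteMeasure (ℝ × ℝ) |
      (q.2 : Measure (ℝ × ℝ)) ∈ partialCouplings (slice q.1 μ) (slice q.1 ν)} :=
  isClosed_partialCouplings.preimage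
    (f := fun q : UnitSphere d × FiniteMeasure (ℝ × ℝ) =>
      ((finiteSlice q.1 μ, finiteSlice q.1 ν), q.2))
    ((((continuous_finiteSlice μ).comp continuous_fst).prodMk
      ((continuous_finiteSlice ν).comp continuous_fst)).prodMk continuous_snd)

theorem lowerSemicontinuous_optCost_slice {c : ℝ → ℝ → ℝ} (hc : ∀ x y, 0 ≤ c x y)
    (hlsc : LowerSemicontinuous fun z : ℝ × ℝ => c z.1 z.2) (μ ν : RadonMeasure Ω) :
    LowerSemicontinuous fun q : (ℝ × UnitSphere d) × FiniteMeasure (ℝ × ℝ) =>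
      optCost c q.1.1 (slice q.1.2 μ) (slice q.1.2 ν) q.2 :=
  (lowerSemicontinuous_optCost hc hlsc).comp
    (g := fun q : (ℝ × UnitSphere d) × FiniteMeasure (ℝ × ℝ) =>
      ((q.1.1, finiteSlice q.1.2 μ, finiteSlice q.1.2 ν), q.2))
    (((continuous_fst.comp continuous_fst).prodMk
      (((continuous_finiteSlice μ).comp (continuous_snd.comp continuous_fst)).prodMk
      ((continuous_finiteSlice ν).comp (continuous_snd.comp continuous_fst)))).prodMk
      continuous_snd)

/-- The partial transport problem between slices has a solution. -/
theorem exists_optCost_eq_OPT {c : ℝ → ℝ → ℝ} (hc : ∀ x y, 0 ≤ c x y)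
    (hlsc : LowerSemicontinuous fun z : ℝ × ℝ => c z.1 z.2) (l : ℝ) (θ : UnitSphere d)
    (μ ν : RadonMeasure Ω) :
    ∃ γ ∈ partialCouplings (slice θ μ) (slice θ ν),
      optCost c l (slice θ μ) (slice θ ν) γ = OPT c l (slice θ μ) (slice θ ν) := by
  obtain ⟨K, hK, hKmem⟩ := exists_isCompact_partialCouplings_slice μ ν
  set P : Set (FiniteMeasure (ℝ × ℝ)) :=
    {γ | (γ : Measure (ℝ × ℝ)) ∈ partialCouplings (slice θ μ) (slice θ ν)} with hP
  have hPc : IsCompact P := hK.of_isClosed_subset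
    ((isClosed_partialCouplings_slice μ ν).preimage (f := fun γ => (θ, γ)) (by fun_prop))
    (fun γ hγ => hKmem θ γ hγ)
  have hl : LowerSemicontinuous fun γ : FiniteMeasure (ℝ × ℝ) =>
      optCost c l (slice θ μ) (slice θ ν) γ :=
    (lowerSemicontinuous_optCost_slice hc hlsc μ ν).comp
      (g := fun γ : FiniteMeasure (ℝ × ℝ) => ((l, θ), γ)) (by fun_prop)
  obtain ⟨γ, hγ, hmin⟩ := (hl.lowerSemicontinuousOn P).exists_isMinOn
    ⟨0, by simpa [hP] using zero_mem_partialCouplings _ _⟩ hPc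
  refine ⟨γ, hγ, le_antisymm (le_iInf₂ fun γ' hγ' => ?_) (OPT_le_optCost hγ)⟩
  have := isFiniteMeasure_of_mem_partialCouplings hγ'
  exact hmin (show (⟨γ', this⟩ : FiniteMeasure (ℝ × ℝ)) ∈ P from hγ')

/-- As the infimum is attained, a sublevel set is the projection of a closed set of pairs
(parameter, coupling); the couplings range over a compact set, and projection along a compact factor
is closed. -/
theorem lowerSemicontinuous_OPT_slice {c : ℝ → ℝ → ℝ} (hc : ∀ x y, 0 ≤ c x y)
    (hlsc : LowerSemicontinuous fun z : ℝ × ℝ => c z.1 z.2) (μ ν : RadonMeasure Ω) :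
    LowerSemicontinuous fun q : ℝ × UnitSphere d => OPT c q.1 (slice q.2 μ) (slice q.2 ν) := by
  obtain ⟨K, hK, hKmem⟩ := exists_isCompact_partialCouplings_slice μ ν
  refine lowerSemicontinuous_iff_isClosed_preimage.2 fun a => ?_
  have : CompactSpace K := isCompact_iff_compactSpace.1 hK
  have hcl : IsClosed {q : (ℝ × UnitSphere d) × K |
      (q.2.1 : Measure (ℝ × ℝ)) ∈ partialCouplings (slice q.1.2 μ) (slice q.1.2 ν) ∧
      optCost c q.1.1 (slice q.1.2 μ) (slice q.1.2 ν) q.2.1 ≤ a} := by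
    refine IsClosed.inter ?_ ?_
    · exact (isClosed_partialCouplings_slice μ ν).preimage
        (f := fun q : (ℝ × UnitSphere d) × K => (q.1.2, q.2.1)) (by fun_prop)
    · exact ((lowerSemicontinuous_optCost_slice hc hlsc μ ν).isClosed_preimage a).preimage
        (f := fun q : (ℝ × UnitSphere d) × K => (q.1, q.2.1)) (by fun_prop)
  convert isClosedMap_fst_of_compactSpace _ hcl using 1
  ext ⟨l, θ⟩
  constructor
  · intro h
    obtain ⟨γ, hγ, hopt⟩ := exists_optCost_eq_OPT hc hlsc l θ μ ν
    have hfin := isFiniteMeasure_of_mem_partialCouplings hγ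
    exact ⟨((l, θ), ⟨⟨γ, hfin⟩, hKmem θ ⟨γ, hfin⟩ hγ⟩), ⟨hγ, hopt.le.trans h⟩, rfl⟩
  · rintro ⟨⟨_, γ⟩, ⟨hγ, hle⟩, rfl⟩
    exact (OPT_le_optCost hγ).trans hle

/-- For a minimizer all three terms vanish. As l > 0, its marginals have full mass and so equal the
slices; as c vanishes only on the diagonal, the two projections agree almost everywhere. -/
theorem slice_eq_of_OPT_eq_zero {c : ℝ → ℝ → ℝ} (hc : ∀ x y, 0 ≤ c x y)
    (hc0 : ∀ x y, c x y = 0 → x = y)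
    (hlsc : LowerSemicontinuous fun z : ℝ × ℝ => c z.1 z.2) {l : ℝ} (hl : 0 < l)
    {θ : UnitSphere d} {μ ν : RadonMeasure Ω} (h : OPT c l (slice θ μ) (slice θ ν) = 0) :
    slice θ μ = slice θ ν := by
  obtain ⟨γ, hγ, hopt⟩ := exists_optCost_eq_OPT hc hlsc l θ μ ν
  have hfin := isFiniteMeasure_of_mem_partialCouplings hγ
  have hl0 : ENNReal.ofReal l ≠ 0 := by simpa using hl
  rw [h, optCost, add_eq_zero, add_eq_zero, mul_eq_zero, mul_eq_zero, or_iff_right hl0,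
    or_iff_right hl0, tsub_eq_zero_iff_le, tsub_eq_zero_iff_le,
    lintegral_eq_zero_iff hlsc.measurable.ennreal_ofReal] at hopt
  obtain ⟨⟨hcost, h1⟩, h2⟩ := hopt
  have e1 : γ.map Prod.fst = slice θ μ := Measure.eq_of_le_of_measure_univ_eq hγ.1
    (le_antisymm (hγ.1 _) h1)
  have e2 : γ.map Prod.snd = slice θ ν := Measure.eq_of_le_of_measure_univ_eq hγ.2
    (le_antisymm (hγ.2 _) h2)
  rw [← e1, ← e2]
  refine Measure.map_congr ?_
  filter_upwards [hcost] with z hz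
  exact hc0 _ _ (le_antisymm (ENNReal.ofReal_eq_zero.1 hz) (hc _ _))

/-- Joint regularity in (l, θ) is what allows the substitution l = λ(θ) for a λ that is only
measurable. -/
theorem aemeasurable_slicedOPT {c : ℝ → ℝ → ℝ} (hc : ∀ x y, 0 ≤ c x y)
    (hlsc : LowerSemicontinuous fun z : ℝ × ℝ => c z.1 z.2) {lam : UnitSphere d → ℝ}
    {σ : Measure (UnitSphere d)} (hlam : AEMeasurable lam σ) (μ ν : RadonMeasure Ω) :
    AEMeasurable (slicedOPT c lam μ ν) σ := by
  have hm : Measurable fun q : ℝ × UnitSphere d => OPT c q.1 (slice q.2 μ) (slice q.2 ν) :=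
    (lowerSemicontinuous_OPT_slice hc hlsc μ ν).measurable
  have hp : AEMeasurable (fun θ => (lam θ, θ)) σ := hlam.prodMk aemeasurable_id
  have h := hm.comp_aemeasurable hp
  rw [Function.comp_def] at h
  exact h

/-! ### Finiteness, symmetry and vanishing on the diagonal. -/

theorem slice_univ (θ : UnitSphere d) (μ : RadonMeasure Ω) :
    slice θ μ Set.univ = μ.1 Set.univ :=
  Measure.map_apply (continuous_slice_fun θ).measurable .univ

theorem SOPT_lt_top (c : ℝ → ℝ → ℝ) {lam : UnitSphere d → ℝ} {σ : Measure (UnitSphere d)}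
    (hlam : Integrable lam σ) (μ ν : RadonMeasure Ω) : SOPT c lam σ μ ν < ∞ := by
  have hle : ∀ θ, slicedOPT c lam μ ν θ
      ≤ ENNReal.ofReal (lam θ) * (μ.1 Set.univ + ν.1 Set.univ) := fun θ => by
    refine (OPT_le_optCost (zero_mem_partialCouplings _ _)).trans ?_
    simp [optCost, slice_univ, mul_add]
  refine (lintegral_mono hle).trans_lt ?_
  rw [lintegral_mul_const' _ _ (ENNReal.add_ne_top.2 ⟨measure_ne_top _ _, measure_ne_top _ _⟩)]
  exact ENNReal.mul_lt_top hlam.lintegral_lt_top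
    (ENNReal.add_lt_top.2 ⟨measure_lt_top _ _, measure_lt_top _ _⟩)

theorem OPT_symm_le {c : ℝ → ℝ → ℝ} (hsymm : ∀ x y, c x y = c y x)
    (hcm : Measurable fun z : ℝ × ℝ => c z.1 z.2) (l : ℝ) (μ ν : Measure ℝ) :
    OPT c l ν μ ≤ OPT c l μ ν := by
  refine le_iInf₂ fun γ hγ => ?_
  have h1 : (γ.map Prod.swap).map Prod.fst = γ.map Prod.snd := by
    rw [Measure.map_map measurable_fst measurable_swap]; rfl
  have h2 : (γ.map Prod.swap).map Prod.snd = γ.map Prod.fst := by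
    rw [Measure.map_map measurable_snd measurable_swap]; rfl
  refine (OPT_le_optCost (γ := γ.map Prod.swap) ⟨h1 ▸ hγ.2, h2 ▸ hγ.1⟩).trans_eq ?_
  rw [optCost, optCost, h1, h2, lintegral_map hcm.ennreal_ofReal measurable_swap, add_right_comm]
  simp only [Prod.fst_swap, Prod.snd_swap]
  simp_rw [fun z : ℝ × ℝ => hsymm z.2 z.1]

theorem OPT_symm {c : ℝ → ℝ → ℝ} (hsymm : ∀ x y, c x y = c y x)
    (hcm : Measurable fun z : ℝ × ℝ => c z.1 z.2) (l : ℝ) (μ ν : Measure ℝ) :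
    OPT c l ν μ = OPT c l μ ν :=
  le_antisymm (OPT_symm_le hsymm hcm l μ ν) (OPT_symm_le hsymm hcm l ν μ)

theorem OPT_self {c : ℝ → ℝ → ℝ} (hc : ∀ x, c x x = 0)
    (hcm : Measurable fun z : ℝ × ℝ => c z.1 z.2) (l : ℝ) (μ : Measure ℝ) :
    OPT c l μ μ = 0 := by
  have hg : Measurable fun x : ℝ => (x, x) := by fun_prop
  have h1 : (μ.map fun x => (x, x)).map Prod.fst = μ := by
    rw [Measure.map_map measurable_fst hg]; exact Measure.map_id
  have h2 : (μ.map fun x => (x, x)).map Prod.snd = μ := by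
    rw [Measure.map_map measurable_snd hg]; exact Measure.map_id
  refine le_antisymm ((OPT_le_optCost (γ := μ.map fun x => (x, x)) ⟨h1.le, h2.le⟩).trans ?_)
    zero_le
  rw [optCost, h1, h2, lintegral_map hcm.ennreal_ofReal hg]
  simp [hc]

/-! ### Slices determine the measure. -/

/-- Finite measures on `Ω` with the same slices in all directions are equal. -/
theorem eq_of_forall_slice_eq [Nonempty (UnitSphere d)] {μ ν : RadonMeasure Ω}
    (h : ∀ θ : UnitSphere d, slice θ μ = slice θ ν) : μ = ν := by
  have hchar : ∀ (ρ : RadonMeasure Ω) (t : ℝ) (θ : UnitSphere d),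
      charFun (ρ.1.map Subtype.val) (t • (θ : EuclideanSpace ℝ (Fin d)))
        = charFun (slice θ ρ) t := by
    intro ρ t θ
    rw [charFun_apply, charFun_apply_real, slice,
      integral_map measurable_subtype_coe.aemeasurable (by fun_prop),
      integral_map (continuous_slice_fun θ).measurable.aemeasurable (by fun_prop)]
    refine integral_congr_ae (ae_of_all _ fun x => ?_)
    simp only [inner_smul_right, real_inner_comm, Complex.ofReal_mul]
  have hmap : μ.1.map Subtype.val = ν.1.map (Subtype.val : Ω → EuclideanSpace ℝ (Fin d)) := by
    refine Measure.ext_of_charFun (funext fun y => ?_)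
    obtain ⟨t, θ, rfl⟩ : ∃ (t : ℝ) (θ : UnitSphere d),
        t • (θ : EuclideanSpace ℝ (Fin d)) = y := by
      rcases eq_or_ne y 0 with rfl | hy
      -- The origin lies on every line, so any direction serves; the sphere must be nonempty for
      -- this.
      · exact ⟨0, Classical.arbitrary _, zero_smul _ _⟩
      · refine ⟨‖y‖, ⟨‖y‖⁻¹ • y, ?_⟩, ?_⟩
        · simp [norm_smul, norm_ne_zero_iff.2 hy]
        · simp [smul_smul, norm_ne_zero_iff.2 hy]
    rw [hchar, hchar, h]
  refine Subtype.ext (Measure.ext fun s hs => ?_)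
  obtain ⟨t, ht, rfl⟩ := hs
  rw [← Measure.map_apply measurable_subtype_coe ht, hmap,
    Measure.map_apply measurable_subtype_coe ht]

/-- The directions in which the slices agree form a closed set of full measure, which therefore
contains the support of σ. That σ ≠ 0 guarantees that some direction exists. -/
theorem eq_of_ae_slice_eq {σ : Measure (UnitSphere d)} [NeZero σ]
    (hσ : σ.support = Set.univ) {μ ν : RadonMeasure Ω}
    (h : ∀ᵐ θ ∂σ, slice θ μ = slice θ ν) : μ = ν := by
  have : Nonempty (UnitSphere d) := σ.nonempty_of_neZero
  have hcl : IsClosed {θ : UnitSphere d | finiteSlice θ μ = finiteSlice θ ν} :=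
    isClosed_eq (continuous_finiteSlice μ) (continuous_finiteSlice ν)
  have hsub := Measure.support_subset_of_isClosed (μ := σ) hcl
    (by filter_upwards [h] with θ hθ using Subtype.ext hθ)
  rw [hσ] at hsub
  exact eq_of_forall_slice_eq fun θ => congrArg Subtype.val (hsub (Set.mem_univ θ))

end SlicedOPT

/-! ### The metric axioms for the sliced cost. -/

theorem mainTheorem1 (d : ℕ) (Ω : Set (EuclideanSpace ℝ (Fin d)))
    (p : ℝ) (hp : 1 ≤ p)
    (c : ℝ → ℝ → ℝ)
    (hc_metric : ∃ D : ℝ → ℝ → ℝ, SlicedOPT.IsMetric D ∧ ∀ x y, c x y = D x y ^ p)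
    (hc_lsc : LowerSemicontinuous (fun z : ℝ × ℝ => c z.1 z.2))
    (σ : Measure (SlicedOPT.UnitSphere d)) [IsProbabilityMeasure σ]
    (hσ : σ.support = Set.univ)
    (lam : SlicedOPT.UnitSphere d → ℝ) (hlam_pos : ∀ θ, 0 < lam θ)
    (hlam_int : Integrable lam σ) :
    -- the integral defining `SOPT` makes sense and is finite
    (∀ μ ν : SlicedOPT.RadonMeasure Ω, AEMeasurable (SlicedOPT.slicedOPT c lam μ ν) σ) ∧
    (∀ μ ν : SlicedOPT.RadonMeasure Ω, SlicedOPT.SOPT c lam σ μ ν < ∞) ∧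
    -- its `p`-th root is a metric on the Radon measures on `Ω`
    SlicedOPT.IsMetric (fun μ ν : SlicedOPT.RadonMeasure Ω =>
      (SlicedOPT.SOPT c lam σ μ ν).toReal ^ (1 / p)) := by
  open SlicedOPT in
  obtain ⟨D, hD, hcD⟩ := hc_metric
  have hp0 : 0 < p := by linarith
  have hc : ∀ x y, 0 ≤ c x y := fun x y => hcD x y ▸ Real.rpow_nonneg (hD.nonneg x y) p
  have hc0 : ∀ x y, c x y = 0 ↔ x = y := fun x y => by
    rw [hcD, Real.rpow_eq_zero (hD.nonneg x y) hp0.ne', hD.eq_zero_iff]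
  have hsymm : ∀ x y, c x y = c y x := fun x y => by rw [hcD, hcD, hD.symm]
  have hcm : Measurable fun z : ℝ × ℝ => c z.1 z.2 := hc_lsc.measurable
  have hmeas : ∀ μ ν : RadonMeasure Ω, AEMeasurable (slicedOPT c lam μ ν) σ := fun μ ν =>
    aemeasurable_slicedOPT hc hc_lsc hlam_int.aemeasurable μ ν
  have hfin : ∀ μ ν : RadonMeasure Ω, SOPT c lam σ μ ν < ∞ := SOPT_lt_top c hlam_int
  refine ⟨hmeas, hfin, fun μ ν => by positivity, fun μ ν => ?_, fun μ ν => ?_, fun μ ν ρ => ?_⟩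
  -- Since `toReal` also sends ∞ to 0, finiteness is needed to conclude that the cost itself
  -- vanishes.
  · rw [Real.rpow_eq_zero ENNReal.toReal_nonneg (by positivity), ENNReal.toReal_eq_zero_iff,
      or_iff_left (hfin μ ν).ne]
    constructor
    · intro h
      rw [SOPT, lintegral_eq_zero_iff' (hmeas μ ν)] at h
      refine eq_of_ae_slice_eq hσ ?_
      filter_upwards [h] with θ hθ
      exact slice_eq_of_OPT_eq_zero hc (fun x y => (hc0 x y).1) hc_lsc (hlam_pos θ) hθ
    · rintro rfl
      have h0 : ∀ θ, slicedOPT c lam μ μ θ = 0 := fun θ =>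
        OPT_self (fun x => (hc0 x x).2 rfl) hcm _ _
      simp [SOPT, h0]
  · have h : ∀ θ, slicedOPT c lam μ ν θ = slicedOPT c lam ν μ θ := fun θ =>
      OPT_symm hsymm hcm _ _ _
    simp only [SOPT, h]
  · have hroot : ∀ μ ν : RadonMeasure Ω, SOPT c lam σ μ ν
        = ∫⁻ θ, (slicedOPT c lam μ ν θ ^ (1 / p)) ^ p ∂σ := fun μ ν => by
      simp_rw [← ENNReal.rpow_mul, one_div_mul_cancel hp0.ne', ENNReal.rpow_one]
      rfl
    have hne : ∀ μ ν : RadonMeasure Ω, SOPT c lam σ μ ν ^ (1 / p) ≠ ∞ := fun μ ν =>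
      ENNReal.rpow_ne_top_of_nonneg (by positivity) (hfin μ ν).ne
    have hle : SOPT c lam σ μ ρ ^ (1 / p)
        ≤ SOPT c lam σ μ ν ^ (1 / p) + SOPT c lam σ ν ρ ^ (1 / p) := by
      rw [hroot μ ρ, hroot μ ν, hroot ν ρ]
      -- Minkowski in L^p(σ) for the p-th roots of the integrands, after the pointwise triangle
      -- inequality.
      refine le_trans (ENNReal.rpow_le_rpow (lintegral_mono fun θ => ?_) (by positivity))
        (ENNReal.lintegral_Lp_add_le ((hmeas μ ν).pow_const _) ((hmeas ν ρ).pow_const _) hp)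
      exact ENNReal.rpow_le_rpow (OPT_rpow_triangle hp hD hcD hcm _ _ _) hp0.le
    simp only [ENNReal.toReal_rpow]
    rw [← ENNReal.toReal_add (hne μ ν) (hne ν ρ)]
    exact ENNReal.toReal_mono (ENNReal.add_ne_top.2 ⟨hne μ ν, hne ν ρ⟩) hle
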